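/- Let $\mathcal X$ be a complete separable metric space with its Borel $\sigma$-algebra, let $n\ge 0$, and let $\xi_1,\dots,\xi_n$ be independent (not necessarily identically distributed) $\mathcal X$-valued random variables on a probability space $(\Omega,\mathcal F,\mathbf P)$. Let $\mathcal A$ be a collection of subsets of $\mathcal X$. For $x=(x_1,\dots,x_n)\in\mathcal X^n$ let $$T(x)=\bigl|\{A\cap\{x_1,\dots,x_n\}:\ A\in\mathcal A\}\bigr|$$ be the shatter coefficient of $\mathcal A$ in $x$, and let $H(x)=\log_2 T(x)$ be the VC entropy, with the convention $\log_2 0=-1$. Assume that the function $x\mapsto H(x)$ on $\mathcal X^n$ is measurable (it suffices that it agrees with a measurable function almost everywhere with respect to the law of $(\xi_1,\dots,\xi_n)$), and denote by $H=H(\xi_1,\dots,\xi_n)$ the random VC entropy. If $\mathcal A$ is non-empty, then $$\operatorname{Var}(H)\le \mathbf E[H].$$ Moreover, for every (possibly empty) $\mathcal A$ and every $t>0$, $$\mathbf P\bigl(H-\mathbf E[H]\ge t\bigr)\le \exp\left\{-\frac{t^2}{2\left(\operatorname{Var}(H)+\frac{2^{3/2}}{3}\,t\sqrt n\right)}\right\},$$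 and the same inequality holds with $H$ replaced by $-H$. (For $n=0$ the left-hand side is $0$ and the inequality is trivial.) -/

import Mathlib

open MeasureTheory ProbabilityTheory

/-- The trace of the class `A` on `x = (x₁, …, xₙ)`: the family of all sets
`a ∩ {x₁, …, xₙ}` with `a ∈ A`. -/
def vcTrace {X : Type*} (A : Set (Set X)) {n : ℕ} (x : Fin n → X) : Set (Set X) :=
  {s | ∃ a ∈ A, s = a ∩ Set.range x}

/-- The shatter coefficient of `A` in `x`: the size of the trace (which is a finite family). -/
noncomputable def shatterCoeff {X : Type*} (A : Set (Set X)) {n : ℕ} (x : Fin n → X) : ℕ :=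
  (vcTrace A x).ncard

/-- The trace is finite, so that `Set.ncard` really is its number of elements. -/
theorem vcTrace_finite {X : Type*} (A : Set (Set X)) {n : ℕ} (x : Fin n → X) :
    (vcTrace A x).Finite := by
  refine (Set.finite_range x).finite_subsets.subset ?_
  rintro s ⟨a, _, rfl⟩
  exact Set.inter_subset_right

/-- The VC entropy `log₂ T(x)` of the shatter coefficient, with the convention `log₂ 0 = -1`. -/
noncomputable def vcEntropy {X : Type*} (A : Set (Set X)) {n : ℕ} (x : Fin n → X) : ℝ :=
  if shatterCoeff A x = 0 then -1 else Real.logb 2 (shatterCoeff A x)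

/-- The random VC entropy `H(ξ₁, …, ξₙ)`. -/
noncomputable def randomVCEntropy {Ω X : Type*} (A : Set (Set X)) {n : ℕ}
    (ξ : Fin n → Ω → X) : Ω → ℝ :=
  fun ω => vcEntropy A (fun i => ξ i ω)

/-! For non-empty `A` the entropy is self-bounding: with `H_k` the entropy after deleting the `k`-th
point, `0 ≤ H - H_k ≤ 1` and `∑ (H - H_k) ≤ H`. To see the sum bound, regard the trace as a family
of `T` vertices of the cube. Deletion collapses the `e_k` edges in direction `k`, so `T_k = T -
e_k`; a chord bound for the logarithm gives `H - H_k ≤ 2 e_k / T`, and edge isoperimetry gives `2 ∑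
e_k ≤ T log₂ T`.

Given the other coordinates, the entropy takes values in `[H_k, H_k + 1]`, so its conditional
variance is at most its conditional mean minus `H_k`. Efron–Stein and the sum bound yield `Var H ≤ E
H` (`variance_pi_le_integral_of_selfBounding`).

The tail bound only needs that `H` moves by at most `1` per coordinate. Cantelli's inequality, which
sees the true variance, handles `t ≤ 3 √n`; bounded differences handle larger `t`
(`measureReal_ge_le_exp_of_hasSubgaussianMGF`). -/

section Cube

/-! ### Edge isoperimetry in the cube. -/

open Finset

variable {α : Type*} [DecidableEq α]

theorem memberSubfamily_inter_nonMemberSubfamily_memberSubfamily {a b : α} (h : b ≠ a)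
    (F : Finset (Finset α)) :
    (F.memberSubfamily a).memberSubfamily b ∩ (F.memberSubfamily a).nonMemberSubfamily b =
      (F.memberSubfamily b ∩ F.nonMemberSubfamily b).memberSubfamily a := by
  ext s
  simp only [mem_inter, mem_memberSubfamily, mem_nonMemberSubfamily, mem_insert, h, h.symm,
    Finset.insert_comm b a s]
  tauto

theorem nonMemberSubfamily_inter_nonMemberSubfamily_memberSubfamily {a b : α} (h : b ≠ a)
    (F : Finset (Finset α)) :
    (F.nonMemberSubfamily a).memberSubfamily b ∩ (F.nonMemberSubfamily a).nonMemberSubfamily b =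
      (F.memberSubfamily b ∩ F.nonMemberSubfamily b).nonMemberSubfamily a := by
  ext s
  simp only [mem_inter, mem_memberSubfamily, mem_nonMemberSubfamily, mem_insert, h.symm]
  tauto

/-- The number of edges of the cube in direction `a` with both ends in `F`. -/
def edgeCount (F : Finset (Finset α)) (a : α) : ℕ :=
  #(F.memberSubfamily a ∩ F.nonMemberSubfamily a)

theorem edgeCount_eq_add {a b : α} (h : b ≠ a) (F : Finset (Finset α)) :
    edgeCount F b =
      edgeCount (F.memberSubfamily a) b + edgeCount (F.nonMemberSubfamily a) b := by
  simp only [edgeCount]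
  rw [memberSubfamily_inter_nonMemberSubfamily_memberSubfamily h,
    nonMemberSubfamily_inter_nonMemberSubfamily_memberSubfamily h,
    card_memberSubfamily_add_card_nonMemberSubfamily]

/-- Erasing `a` identifies exactly the two ends of each edge in direction `a`. -/
theorem card_image_erase_add_edgeCount (F : Finset (Finset α)) (a : α) :
    #(F.image fun s => s.erase a) + edgeCount F a = #F := by
  rw [edgeCount, ← memberSubfamily_union_nonMemberSubfamily, card_union_add_card_inter,
    card_memberSubfamily_add_card_nonMemberSubfamily]

theorem two_mul_edgeCount_le (F : Finset (Finset α)) (a : α) : 2 * edgeCount F a ≤ #F := by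
  have h₁ : edgeCount F a ≤ #(F.memberSubfamily a) := card_le_card inter_subset_left
  have h₂ : edgeCount F a ≤ #(F.nonMemberSubfamily a) := card_le_card inter_subset_right
  have := card_memberSubfamily_add_card_nonMemberSubfamily a F
  omega

/-- The chord of `u ↦ -log (1 - u / 2)` on `[0, 1]` lies above its graph. -/
theorem neg_log_one_sub_half_le {u : ℝ} (h₀ : 0 ≤ u) (h₁ : u ≤ 1) :
    -Real.log (1 - u / 2) ≤ u * Real.log 2 := by
  have h := strictConcaveOn_log_Ioi.concaveOn.2
    (show (1 : ℝ) ∈ Set.Ioi 0 by simp) (show (1 / 2 : ℝ) ∈ Set.Ioi 0 by simp)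
    (sub_nonneg.2 h₁) h₀ (by ring)
  simp only [smul_eq_mul, Real.log_one, mul_zero, zero_add] at h
  rw [show (1 - u) * 1 + u * (1 / 2) = 1 - u / 2 by ring, one_div, Real.log_inv] at h
  linarith

/-- At `p = b / (a + b) ≤ 1 / 2`, the concave binary entropy lies above its chord from `0` to `1 /
2`, that is, above `2 p log 2`. -/
theorem mul_log_add_mul_log_add_le {a b : ℝ} (hb : 0 ≤ b) (hab : b ≤ a) :
    a * Real.log a + b * Real.log b + 2 * b * Real.log 2 ≤ (a + b) * Real.log (a + b) := by
  rcases hb.eq_or_lt with rfl | hb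
  · simp
  have ha : 0 < a := hb.trans_le hab
  have hs : 0 < a + b := by positivity
  have hc := Real.strictConcave_binEntropy.concaveOn.2
    (show (0 : ℝ) ∈ Set.Icc 0 1 by constructor <;> norm_num)
    (show (1 / 2 : ℝ) ∈ Set.Icc 0 1 by constructor <;> norm_num)
    (show 0 ≤ 1 - 2 * b / (a + b) by rw [sub_nonneg, div_le_one hs]; linarith)
    (show 0 ≤ 2 * b / (a + b) by positivity) (by ring)
  have hp : (1 - 2 * b / (a + b)) * 0 + 2 * b / (a + b) * (1 / 2) = b / (a + b) := by ring
  simp only [smul_eq_mul, hp] at hc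
  rw [show (1 / 2 : ℝ) = 2⁻¹ by norm_num] at hc
  rw [Real.binEntropy_two_inv, Real.binEntropy_zero, Real.binEntropy] at hc
  rw [show 1 - b / (a + b) = a / (a + b) by field_simp; ring, inv_div, inv_div,
    Real.log_div hs.ne' hb.ne', Real.log_div hs.ne' ha.ne'] at hc
  have := mul_le_mul_of_nonneg_left hc hs.le
  have e₁ : (a + b) * ((1 - 2 * b / (a + b)) * 0 + 2 * b / (a + b) * Real.log 2) =
      2 * b * Real.log 2 := by field_simp; ring
  have e₂ : (a + b) * (b / (a + b) * (Real.log (a + b) - Real.log b) +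
      a / (a + b) * (Real.log (a + b) - Real.log a)) =
      b * (Real.log (a + b) - Real.log b) + a * (Real.log (a + b) - Real.log a) := by
    field_simp
  rw [e₁, e₂] at this
  linarith

/-- The edge-isoperimetric inequality in the cube. -/
theorem two_mul_sum_edgeCount_mul_log_two_le (K : Finset α) (F : Finset (Finset α)) :
    2 * (∑ a ∈ K, (edgeCount F a : ℝ)) * Real.log 2 ≤ #F * Real.log #F := by
  induction K using Finset.induction_on generalizing F with
  | empty =>
    simpa using mul_nonneg (Nat.cast_nonneg (α := ℝ) #F) (Real.log_natCast_nonneg _)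
  | insert a K ha ih =>
    have hsum : ∑ b ∈ K, (edgeCount F b : ℝ) =
        ∑ b ∈ K, (edgeCount (F.memberSubfamily a) b : ℝ) +
        ∑ b ∈ K, (edgeCount (F.nonMemberSubfamily a) b : ℝ) := by
      rw [← sum_add_distrib]
      refine sum_congr rfl fun b hb => ?_
      rw [edgeCount_eq_add (a := a) (by rintro rfl; exact ha hb)]
      push_cast; rfl
    have h₁ := ih (F.memberSubfamily a)
    have h₂ := ih (F.nonMemberSubfamily a)
    have d₁ : (edgeCount F a : ℝ) ≤ #(F.memberSubfamily a) :=
      Nat.cast_le.2 (card_le_card inter_subset_left)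
    have d₂ : (edgeCount F a : ℝ) ≤ #(F.nonMemberSubfamily a) :=
      Nat.cast_le.2 (card_le_card inter_subset_right)
    have hc : (#(F.memberSubfamily a) : ℝ) + #(F.nonMemberSubfamily a) = #F := by
      exact_mod_cast card_memberSubfamily_add_card_nonMemberSubfamily a F
    have hl : 0 < Real.log 2 := Real.log_pos one_lt_two
    rw [sum_insert ha, hsum, ← hc]
    -- The edges in direction `a` number at most the smaller half, which plays the role of `b` in
    -- the two-point inequality.
    rcases le_total (#(F.memberSubfamily a) : ℝ) #(F.nonMemberSubfamily a) with h | h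
    · have := mul_log_add_mul_log_add_le (Nat.cast_nonneg _) h
      rw [add_comm (#(F.nonMemberSubfamily a) : ℝ)] at this
      nlinarith [mul_le_mul_of_nonneg_right d₁ hl.le]
    · have := mul_log_add_mul_log_add_le (Nat.cast_nonneg _) h
      nlinarith [mul_le_mul_of_nonneg_right d₂ hl.le]

/-- The ratio of the two cardinalities is `1 - u / 2` with `u = 2 e / #F`, and `u ≤ 1` because edges
in one direction are disjoint. -/
theorem logb_card_sub_logb_card_image_erase_le {F : Finset (Finset α)} (hF : F.Nonempty) (a : α) :
    Real.logb 2 #F - Real.logb 2 #(F.image fun s => s.erase a) ≤ 2 * edgeCount F a / #F := by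
  have hl : 0 < Real.log 2 := Real.log_pos one_lt_two
  have hT : (0 : ℝ) < #F := by exact_mod_cast hF.card_pos
  have hT' : (0 : ℝ) < #(F.image fun s => s.erase a) := by exact_mod_cast (hF.image _).card_pos
  have h : (#(F.image fun s => s.erase a) : ℝ) + edgeCount F a = #F := by
    exact_mod_cast card_image_erase_add_edgeCount F a
  have h2 : 2 * (edgeCount F a : ℝ) ≤ #F := by exact_mod_cast two_mul_edgeCount_le F a
  have := neg_log_one_sub_half_le (u := 2 * edgeCount F a / #F) (by positivity)
    ((div_le_one hT).2 h2)
  rw [show 1 - 2 * (edgeCount F a : ℝ) / #F / 2 = #(F.image fun s => s.erase a) / #F by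
    rw [← h] at hT ⊢; field_simp; ring, Real.log_div hT'.ne' hT.ne'] at this
  rw [Real.logb, Real.logb, ← sub_div, div_le_iff₀ hl]
  linarith

/-- Han's inequality for the uniform distribution on a family of subsets of a finite type. -/
theorem sum_logb_card_sub_logb_card_image_erase_le [Fintype α] {F : Finset (Finset α)}
    (hF : F.Nonempty) :
    ∑ a, (Real.logb 2 #F - Real.logb 2 #(F.image fun s => s.erase a)) ≤ Real.logb 2 #F := by
  have hl : 0 < Real.log 2 := Real.log_pos one_lt_two
  have hT : (0 : ℝ) < #F := by exact_mod_cast hF.card_pos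
  refine (sum_le_sum fun a _ => logb_card_sub_logb_card_image_erase_le hF a).trans ?_
  rw [← sum_div, ← mul_sum, Real.logb, div_le_div_iff₀ hT hl]
  linarith [two_mul_sum_edgeCount_mul_log_two_le univ F]

theorem logb_card_image_erase_le {F : Finset (Finset α)} (hF : F.Nonempty) (a : α) :
    Real.logb 2 #(F.image fun s => s.erase a) ≤ Real.logb 2 #F :=
  Real.logb_le_logb_of_le one_lt_two (by exact_mod_cast (hF.image _).card_pos)
    (by exact_mod_cast card_image_le)

theorem logb_card_le_add_one {F : Finset (Finset α)} (hF : F.Nonempty) (a : α) :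
    Real.logb 2 #F ≤ Real.logb 2 #(F.image fun s => s.erase a) + 1 := by
  have hT : (0 : ℝ) < #F := by exact_mod_cast hF.card_pos
  have h2 : 2 * (edgeCount F a : ℝ) ≤ #F := by exact_mod_cast two_mul_edgeCount_le F a
  have := logb_card_sub_logb_card_image_erase_le hF a
  linarith [(div_le_one hT).2 h2]

end Cube

/-! ### VC entropy as a function on the cube. -/

section Entropy

variable {X : Type*} {n : ℕ}

open Classical in
/-- The trace of `A` on `x`, as a family of sets of indices. -/
noncomputable def indexTrace (A : Set (Set X)) (x : Fin n → X) : Finset (Finset (Fin n)) :=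
  {s | ∃ a ∈ A, s = ({i | x i ∈ a} : Finset (Fin n))}

theorem shatterCoeff_eq_card (A : Set (Set X)) (x : Fin n → X) :
    shatterCoeff A x = (indexTrace A x).card := by
  classical
  rw [shatterCoeff, ← Set.ncard_coe_finset]
  symm
  -- Injective even when `x` repeats values: each `s` in the index trace is a full preimage under
  -- `x`.
  refine Set.ncard_congr (fun s _ => x '' s) ?_ ?_ ?_
  · intro s hs
    simp only [indexTrace, Finset.coe_filter, Set.mem_ofPred_eq, Finset.mem_univ, true_and] at hs
    obtain ⟨a, ha, rfl⟩ := hs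
    refine ⟨a, ha, ?_⟩
    ext y
    simp only [Finset.coe_filter, Finset.mem_univ, true_and, Set.mem_image, Set.mem_ofPred_eq,
      Set.mem_inter_iff, Set.mem_range]
    constructor
    · rintro ⟨i, hi, rfl⟩
      exact ⟨hi, i, rfl⟩
    · rintro ⟨hy, i, rfl⟩
      exact ⟨i, hy, rfl⟩
  · intro s t hs ht h
    simp only [indexTrace, Finset.coe_filter, Set.mem_ofPred_eq, Finset.mem_univ, true_and] at hs ht
    obtain ⟨a, -, rfl⟩ := hs
    obtain ⟨b, -, rfl⟩ := ht
    ext i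
    simp only [Finset.mem_filter, Finset.mem_univ, true_and]
    have := Set.ext_iff.1 h (x i)
    simp only [Finset.coe_filter, Finset.mem_univ, true_and, Set.mem_image,
      Set.mem_ofPred_eq] at this
    constructor
    · intro hi
      obtain ⟨j, hj, hji⟩ := this.1 ⟨i, hi, rfl⟩
      rwa [← hji]
    · intro hi
      obtain ⟨j, hj, hji⟩ := this.2 ⟨i, hi, rfl⟩
      rwa [← hji]
  · rintro _ ⟨a, ha, rfl⟩
    refine ⟨({i | x i ∈ a} : Finset (Fin n)), by simpa [indexTrace] using ⟨a, ha, rfl⟩, ?_⟩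
    ext y
    simp only [Finset.coe_filter, Finset.mem_univ, true_and, Set.mem_image, Set.mem_ofPred_eq,
      Set.mem_inter_iff, Set.mem_range]
    constructor
    · rintro ⟨i, hi, rfl⟩
      exact ⟨hi, i, rfl⟩
    · rintro ⟨hy, i, rfl⟩
      exact ⟨i, hy, rfl⟩

theorem indexTrace_nonempty {A : Set (Set X)} (hA : A.Nonempty) (x : Fin n → X) :
    (indexTrace A x).Nonempty := by
  classical
  obtain ⟨a, ha⟩ := hA
  exact ⟨({i | x i ∈ a} : Finset (Fin n)), by simpa [indexTrace] using ⟨a, ha, rfl⟩⟩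

theorem image_erase_indexTrace_update (A : Set (Set X)) (x : Fin n → X) (k : Fin n) (y : X) :
    ((indexTrace A (Function.update x k y)).image fun s => s.erase k) =
      (indexTrace A x).image fun s => s.erase k := by
  classical
  have key : ∀ a : Set X, (({i | Function.update x k y i ∈ a} : Finset (Fin n)).erase k) =
      (({i | x i ∈ a} : Finset (Fin n)).erase k) := by
    intro a
    ext i
    by_cases h : i = k <;> simp [h]
  ext s
  simp only [indexTrace, Finset.mem_image, Finset.mem_filter, Finset.mem_univ, true_and]
  constructor
  · rintro ⟨_, ⟨a, ha, rfl⟩, rfl⟩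
    exact ⟨_, ⟨a, ha, rfl⟩, (key a).symm⟩
  · rintro ⟨_, ⟨a, ha, rfl⟩, rfl⟩
    exact ⟨_, ⟨a, ha, rfl⟩, key a⟩

theorem vcEntropy_eq_logb {A : Set (Set X)} (hA : A.Nonempty) (x : Fin n → X) :
    vcEntropy A x = Real.logb 2 (indexTrace A x).card := by
  rw [vcEntropy, shatterCoeff_eq_card, if_neg (indexTrace_nonempty hA x).card_pos.ne']

theorem vcEntropy_empty (x : Fin n → X) : vcEntropy (∅ : Set (Set X)) x = -1 := by
  simp [vcEntropy, shatterCoeff, vcTrace]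

/-- The VC entropy of the sample with the `k`-th point deleted. -/
noncomputable def deletedEntropy (A : Set (Set X)) (k : Fin n) (x : Fin n → X) : ℝ :=
  Real.logb 2 ((indexTrace A x).image fun s => s.erase k).card

theorem deletedEntropy_update (A : Set (Set X)) (k : Fin n) (x : Fin n → X) (y : X) :
    deletedEntropy A k (Function.update x k y) = deletedEntropy A k x := by
  rw [deletedEntropy, image_erase_indexTrace_update, deletedEntropy]

theorem deletedEntropy_le {A : Set (Set X)} (hA : A.Nonempty) (k : Fin n) (x : Fin n → X) :
    deletedEntropy A k x ≤ vcEntropy A x := by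
  rw [vcEntropy_eq_logb hA]
  exact logb_card_image_erase_le (indexTrace_nonempty hA x) k

theorem vcEntropy_le_deletedEntropy_add_one {A : Set (Set X)} (hA : A.Nonempty) (k : Fin n)
    (x : Fin n → X) : vcEntropy A x ≤ deletedEntropy A k x + 1 := by
  rw [vcEntropy_eq_logb hA]
  exact logb_card_le_add_one (indexTrace_nonempty hA x) k

theorem sum_vcEntropy_sub_deletedEntropy_le {A : Set (Set X)} (hA : A.Nonempty)
    (x : Fin n → X) : ∑ k, (vcEntropy A x - deletedEntropy A k x) ≤ vcEntropy A x := by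
  simp only [vcEntropy_eq_logb hA]
  exact sum_logb_card_sub_logb_card_image_erase_le (indexTrace_nonempty hA x)

/-- Both values lie in the same unit interval starting at the deleted entropy, which ignores the
`k`-th point. -/
theorem abs_vcEntropy_update_sub_le (A : Set (Set X)) (x : Fin n → X) (k : Fin n) (y : X) :
    |vcEntropy A (Function.update x k y) - vcEntropy A x| ≤ 1 := by
  rcases A.eq_empty_or_nonempty with rfl | hA
  · simp [vcEntropy_empty]
  have h₁ := deletedEntropy_le hA k x
  have h₂ := vcEntropy_le_deletedEntropy_add_one hA k x
  have h₃ := deletedEntropy_le hA k (Function.update x k y)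
  have h₄ := vcEntropy_le_deletedEntropy_add_one hA k (Function.update x k y)
  rw [deletedEntropy_update] at h₃ h₄
  rw [abs_le]
  constructor <;> linarith

theorem exists_abs_vcEntropy_le (A : Set (Set X)) (n : ℕ) :
    ∃ C : ℝ, ∀ x : Fin n → X, |vcEntropy A x| ≤ C := by
  rcases A.eq_empty_or_nonempty with rfl | hA
  · exact ⟨1, fun x => by simp [vcEntropy_empty]⟩
  refine ⟨Real.logb 2 (Fintype.card (Finset (Fin n))), fun x => ?_⟩
  have h := (indexTrace_nonempty hA x).card_pos
  rw [vcEntropy_eq_logb hA, abs_of_nonneg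
    (Real.logb_nonneg one_lt_two (by exact_mod_cast h))]
  exact Real.logb_le_logb_of_le one_lt_two (by exact_mod_cast h)
    (by exact_mod_cast Finset.card_le_univ _)

end Entropy

/-! ### Variance on a product of two spaces. -/

section Product

variable {α β : Type*} [MeasurableSpace α] [MeasurableSpace β]

theorem integrable_of_abs_le {μ : Measure α} [IsFiniteMeasure μ] {f : α → ℝ} {C : ℝ}
    (hf : AEStronglyMeasurable f μ) (hC : ∀ x, |f x| ≤ C) : Integrable f μ :=
  .of_bound hf C (.of_forall hC)

theorem memLp_two_of_abs_le {μ : Measure α} [IsFiniteMeasure μ] {f : α → ℝ} {C : ℝ}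
    (hf : AEStronglyMeasurable f μ) (hC : ∀ x, |f x| ≤ C) : MemLp f 2 μ :=
  .of_bound hf C (.of_forall hC)

theorem abs_integral_le_of_abs_le {μ : Measure α} [IsProbabilityMeasure μ] {f : α → ℝ} {C : ℝ}
    (hC : ∀ x, |f x| ≤ C) : |∫ x, f x ∂μ| ≤ C := by
  simpa using norm_integral_le_of_norm_le_const (μ := μ) (f := f) (C := C) (.of_forall hC)

theorem sq_integral_le_integral_sq {μ : Measure α} [IsProbabilityMeasure μ] {f : α → ℝ}
    (hf : MemLp f 2 μ) : (∫ x, f x ∂μ) ^ 2 ≤ ∫ x, f x ^ 2 ∂μ := by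
  have h := variance_nonneg f μ
  rw [variance_eq_sub hf] at h
  simpa using h

theorem integrable_sq_of_abs_le {μ : Measure α} [IsFiniteMeasure μ] {f : α → ℝ} {C : ℝ}
    (hf : AEStronglyMeasurable f μ) (hC : ∀ x, |f x| ≤ C) : Integrable (fun x => f x ^ 2) μ :=
  (memLp_two_of_abs_le hf hC).integrable_sq

variable (μ : Measure α) (ν : Measure β) [IsProbabilityMeasure μ] [IsProbabilityMeasure ν]

theorem integrable_variance_section {f : α × β → ℝ} {C : ℝ}
    (hf : AEStronglyMeasurable f (μ.prod ν)) (hC : ∀ p, |f p| ≤ C) :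
    Integrable (fun x => Var[fun y => f (x, y); ν]) μ ∧
    ∫ x, Var[fun y => f (x, y); ν] ∂μ =
      ∫ p, f p ^ 2 ∂μ.prod ν - ∫ x, (∫ y, f (x, y) ∂ν) ^ 2 ∂μ := by
  have hsq := integrable_sq_of_abs_le hf hC
  have hg : Integrable (fun x => (∫ y, f (x, y) ∂ν) ^ 2) μ :=
    integrable_sq_of_abs_le hf.integral_prod_right' fun x =>
      abs_integral_le_of_abs_le fun y => hC (x, y)
  have h : (fun x => Var[fun y => f (x, y); ν]) =ᵐ[μ]
      fun x => ∫ y, f (x, y) ^ 2 ∂ν - (∫ y, f (x, y) ∂ν) ^ 2 := by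
    filter_upwards [hf.prodMk_left] with x hx
    rw [variance_eq_sub (memLp_two_of_abs_le hx fun y => hC (x, y))]
    simp
  have hi := hsq.integral_prod_left
  refine ⟨(hi.sub hg).congr h.symm, ?_⟩
  rw [integral_congr_ae h, integral_sub hi hg, integral_prod _ hsq]

/-- The decomposition of the variance on a product. -/
theorem variance_prod_eq {f : α × β → ℝ} {C : ℝ}
    (hf : AEStronglyMeasurable f (μ.prod ν)) (hC : ∀ p, |f p| ≤ C) :
    Var[f; μ.prod ν] =
      ∫ x, Var[fun y => f (x, y); ν] ∂μ + Var[fun x => ∫ y, f (x, y) ∂ν; μ] := by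
  rw [(integrable_variance_section μ ν hf hC).2, variance_eq_sub (memLp_two_of_abs_le hf hC),
    variance_eq_sub (memLp_two_of_abs_le hf.integral_prod_right' fun x =>
      abs_integral_le_of_abs_le fun y => hC (x, y)), integral_prod _ (integrable_of_abs_le hf hC)]
  simp

/-- Centre each section in `x`, then apply Jensen in `y` to the square and swap the integrals. -/
theorem variance_integral_le_integral_variance {f : α × β → ℝ} {C : ℝ}
    (hf : AEStronglyMeasurable f (μ.prod ν)) (hC : ∀ p, |f p| ≤ C) :
    Var[fun x => ∫ y, f (x, y) ∂ν; μ] ≤ ∫ y, Var[fun x => f (x, y); μ] ∂ν := by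
  have hm : AEStronglyMeasurable (fun y => ∫ x, f (x, y) ∂μ) ν :=
    hf.prod_swap.integral_prod_right'
  have hmC : ∀ y, |∫ x, f (x, y) ∂μ| ≤ C := fun y => abs_integral_le_of_abs_le fun x => hC (x, y)
  have hF : AEStronglyMeasurable (fun p : α × β => f p - ∫ x, f (x, p.2) ∂μ) (μ.prod ν) :=
    hf.sub hm.comp_snd
  have hFC : ∀ p : α × β, |f p - ∫ x, f (x, p.2) ∂μ| ≤ C + C := fun p =>
    (abs_sub _ _).trans (add_le_add (hC p) (hmC p.2))
  have hFsq := integrable_sq_of_abs_le hF hFC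
  have hfi := integrable_of_abs_le hf hC
  have hmean : ∫ x, ∫ y, f (x, y) ∂ν ∂μ = ∫ y, ∫ x, f (x, y) ∂μ ∂ν :=
    integral_integral_swap hfi
  rw [variance_eq_integral hf.integral_prod_right'.aemeasurable, hmean]
  calc ∫ x, (∫ y, f (x, y) ∂ν - ∫ y, ∫ x, f (x, y) ∂μ ∂ν) ^ 2 ∂μ
      ≤ ∫ x, ∫ y, (f (x, y) - ∫ x', f (x', y) ∂μ) ^ 2 ∂ν ∂μ := by
        refine integral_mono_ae (integrable_sq_of_abs_le (C := C + C)
          (hf.integral_prod_right'.sub aestronglyMeasurable_const) fun x => ?_)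
          hFsq.integral_prod_left ?_
        · exact (abs_sub _ _).trans (add_le_add
            (abs_integral_le_of_abs_le fun y => hC (x, y)) (abs_integral_le_of_abs_le hmC))
        · filter_upwards [hf.prodMk_left] with x hx
          rw [← integral_sub (integrable_of_abs_le hx fun y => hC (x, y))
            (integrable_of_abs_le hm hmC)]
          exact sq_integral_le_integral_sq
            (memLp_two_of_abs_le (hx.sub hm) fun y => hFC (x, y))
    _ = ∫ y, ∫ x, (f (x, y) - ∫ x', f (x', y) ∂μ) ^ 2 ∂μ ∂ν := integral_integral_swap hFsq
    _ = ∫ y, Var[fun x => f (x, y); μ] ∂ν := by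
        refine integral_congr_ae ?_
        filter_upwards [hf.prodMk_right] with y hy
        rw [variance_eq_integral hy.aemeasurable]

end Product

/-! ### Efron–Stein and bounded differences, by induction on the number of coordinates. -/

section Pi

variable {X : Type*} [MeasurableSpace X] {n : ℕ}

theorem measurePreserving_cons (μ : Fin (n + 1) → Measure X) [∀ i, IsProbabilityMeasure (μ i)] :
    MeasurePreserving (fun p : X × (Fin n → X) => (Fin.cons p.1 p.2 : Fin (n + 1) → X))
      ((μ 0).prod (Measure.pi fun i => μ i.succ)) (Measure.pi μ) := by
  convert (measurePreserving_piFinSuccAbove μ 0).symm using 1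
  · ext p
    simp [MeasurableEquiv.piFinSuccAbove_symm_apply, Fin.insertNthEquiv]
  · simp only [Fin.succAbove_zero]

/-- Resampling one coordinate independently leaves the product law unchanged. -/
theorem measurePreserving_update (μ : Fin n → Measure X) [∀ i, IsProbabilityMeasure (μ i)]
    (k : Fin n) :
    MeasurePreserving (fun p : (Fin n → X) × X => Function.update p.1 k p.2)
      ((Measure.pi μ).prod (μ k)) (Measure.pi μ) := by
  have hm : Measurable fun p : (Fin n → X) × X => Function.update p.1 k p.2 :=
    measurable_pi_lambda _ fun i => by
      by_cases h : i = k
      · subst h; simpa using measurable_snd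
      · simp only [Function.update_of_ne h]
        exact (measurable_pi_apply i).comp measurable_fst
  refine ⟨hm, (Measure.pi_eq fun s hs => ?_).symm⟩
  have hpre : (fun p : (Fin n → X) × X => Function.update p.1 k p.2) ⁻¹' Set.univ.pi s =
      (Set.univ.pi (Function.update s k Set.univ)) ×ˢ s k := by
    ext p
    simp only [Set.mem_preimage, Set.mem_pi, Set.mem_univ, true_imp_iff, Set.mem_prod]
    constructor
    · refine fun h => ⟨fun i => ?_, by simpa using h k⟩
      by_cases hi : i = k
      · subst hi; simp
      · simpa [hi] using h i
    · rintro ⟨h, hk⟩ i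
      by_cases hi : i = k
      · subst hi; simpa using hk
      · simpa [hi] using h i
  rw [Measure.map_apply hm (.univ_pi hs), hpre, Measure.prod_prod, Measure.pi_pi,
    ← Finset.prod_erase_mul _ _ (Finset.mem_univ k), ← Finset.prod_erase_mul _ _
    (Finset.mem_univ k)]
  simp only [Function.update_self, measure_univ, mul_one]
  congr 1
  exact Finset.prod_congr rfl fun i hi => by rw [Function.update_of_ne (Finset.ne_of_mem_erase hi)]

theorem integrable_variance_update (μ : Fin n → Measure X) [∀ i, IsProbabilityMeasure (μ i)]
    {f : (Fin n → X) → ℝ} {C : ℝ} (hf : AEStronglyMeasurable f (Measure.pi μ))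
    (hC : ∀ x, |f x| ≤ C) (k : Fin n) :
    Integrable (fun x => Var[fun y => f (Function.update x k y); μ k]) (Measure.pi μ) :=
  (integrable_variance_section _ _
    (hf.comp_measurePreserving (measurePreserving_update μ k)) fun _ => hC _).1

/-- The Efron–Stein inequality. -/
theorem variance_pi_le_sum (μ : Fin n → Measure X) [∀ i, IsProbabilityMeasure (μ i)]
    {f : (Fin n → X) → ℝ} {C : ℝ} (hf : AEStronglyMeasurable f (Measure.pi μ))
    (hC : ∀ x, |f x| ≤ C) :
    Var[f; Measure.pi μ] ≤
      ∑ k, ∫ x, Var[fun y => f (Function.update x k y); μ k] ∂Measure.pi μ := by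
  induction n with
  | zero =>
    have : f = fun _ => f Fin.elim0 := funext fun x => congrArg f (Subsingleton.elim _ _)
    rw [this, variance_eq_integral aemeasurable_const]
    simp
  | succ n ih =>
    have hcons := measurePreserving_cons μ
    set π := Measure.pi fun i : Fin n => μ i.succ with hπ
    have hF : AEStronglyMeasurable (fun p : X × (Fin n → X) => f (Fin.cons p.1 p.2))
        ((μ 0).prod π) := hf.comp_measurePreserving hcons
    have hv := integrable_variance_update μ hf hC
    have htransfer : ∀ k, ∫ x, Var[fun y => f (Function.update x k y); μ k] ∂Measure.pi μ =
        ∫ a, ∫ z, Var[fun y => f (Function.update (Fin.cons a z : Fin (n + 1) → X) k y); μ k] ∂π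
          ∂μ 0 := fun k => by
      rw [← hcons.map_eq, integral_map hcons.aemeasurable (hcons.map_eq ▸ (hv k).1)]
      exact integral_prod _ ((hcons.integrable_comp (hv k).1).2 (hv k))
    rw [← hcons.variance_fun_comp hf.aemeasurable, variance_prod_eq _ _ hF fun p => hC _,
      Fin.sum_univ_succ, add_comm]
    -- The variance of the average over the later coordinates pays for coordinate `0`; the mean
    -- section variance is bounded by induction.
    refine add_le_add ?_ ?_
    · refine (variance_integral_le_integral_variance _ _ hF fun p => hC _).trans_eq ?_
      rw [htransfer]
      simp only [Fin.update_cons_zero]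
      simp
    · simp only [htransfer]
      have hint : ∀ k : Fin n, Integrable (fun a => ∫ z, Var[fun y => f
          (Function.update (Fin.cons a z : Fin (n + 1) → X) k.succ y); μ k.succ] ∂π) (μ 0) :=
        fun k => ((hcons.integrable_comp (hv k.succ).1).2 (hv k.succ)).integral_prod_left
      rw [← integral_finsetSum _ fun k _ => hint k]
      refine integral_mono_ae (integrable_variance_section _ _ hF fun p => hC _).1
        (integrable_finsetSum _ fun k _ => hint k) ?_
      filter_upwards [hF.prodMk_left] with a ha
      simpa only [← Fin.cons_update] using ih (fun i => μ i.succ) ha fun z => hC _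

/-- The bounded differences inequality, for the moment generating function. -/
theorem integral_exp_mul_sub_le (μ : Fin n → Measure X) [∀ i, IsProbabilityMeasure (μ i)]
    {f : (Fin n → X) → ℝ} {C : ℝ} (hf : AEStronglyMeasurable f (Measure.pi μ))
    (hC : ∀ x, |f x| ≤ C) (hd : ∀ x k y, |f (Function.update x k y) - f x| ≤ 1) (t : ℝ) :
    ∫ x, Real.exp (t * (f x - ∫ x', f x' ∂Measure.pi μ)) ∂Measure.pi μ ≤
      Real.exp (n * t ^ 2 / 2) := by
  induction n with
  | zero =>
    have : f = fun _ => f Fin.elim0 := funext fun x => congrArg f (Subsingleton.elim _ _)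
    rw [this]
    simp
  | succ n ih =>
    have hcons := measurePreserving_cons μ
    set π := Measure.pi fun i : Fin n => μ i.succ with hπ
    have hF : AEStronglyMeasurable (fun p : X × (Fin n → X) => f (Fin.cons p.1 p.2))
        ((μ 0).prod π) := hf.comp_measurePreserving hcons
    have hFi := integrable_of_abs_le hF fun p => hC _
    set m := ∫ x', f x' ∂Measure.pi μ with hm
    set g : X → ℝ := fun a => ∫ z, f (Fin.cons a z) ∂π with hg
    have hgm : AEStronglyMeasurable g (μ 0) := hF.integral_prod_right'
    have hgmean : ∫ a, g a ∂μ 0 = m := by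
      rw [hm, ← hcons.map_eq, integral_map hcons.aemeasurable (hcons.map_eq ▸ hf),
        integral_prod _ hFi]
    have hexp : AEStronglyMeasurable (fun x => Real.exp (t * (f x - m))) (Measure.pi μ) :=
      Real.continuous_exp.comp_aestronglyMeasurable
        ((hf.sub aestronglyMeasurable_const).const_mul t)
    have hexpC : ∀ x, |Real.exp (t * (f x - m))| ≤ Real.exp (|t| * (C + |m|)) := fun x => by
      rw [abs_of_pos (Real.exp_pos _), Real.exp_le_exp]
      refine (le_abs_self _).trans ?_
      rw [abs_mul]
      gcongr
      exact (abs_sub _ _).trans (by gcongr; exact hC x)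
    have hexpi := integrable_of_abs_le hexp hexpC
    have hexpi' := (hcons.integrable_comp hexpi.1).2 hexpi
    -- the average over the last coordinates has bounded oscillation
    obtain ⟨a₀, ha₀⟩ := hF.prodMk_left.exists
    have hgb : ∀ᵐ a ∂μ 0, g a ∈ Set.Icc (g a₀ - 1) (g a₀ + 1) := by
      filter_upwards [hF.prodMk_left] with a ha
      have : |g a - g a₀| ≤ 1 := by
        rw [hg]
        simp only
        rw [← integral_sub (integrable_of_abs_le ha fun z => hC _)
          (integrable_of_abs_le ha₀ fun z => hC _)]
        refine abs_integral_le_of_abs_le fun z => ?_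
        have := hd (Fin.cons a₀ z) 0 a
        rwa [Fin.update_cons_zero] at this
      rw [abs_le] at this
      constructor <;> linarith
    -- An interval of length `2` gives Hoeffding variance proxy `1`, hence one factor `exp (t ^ 2 /
    -- 2)` per coordinate.
    have hsub := hasSubgaussianMGF_of_mem_Icc hgm.aemeasurable hgb
    have hmgf := hsub.mgf_le t
    have hmgfi := hsub.integrable_exp_mul t
    rw [hgmean] at hmgf hmgfi
    rw [mgf, show g a₀ + 1 - (g a₀ - 1) = 2 by ring] at hmgf
    calc ∫ x, Real.exp (t * (f x - m)) ∂Measure.pi μ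
        = ∫ a, ∫ z, Real.exp (t * (f (Fin.cons a z) - m)) ∂π ∂μ 0 := by
          rw [← hcons.map_eq, integral_map hcons.aemeasurable (hcons.map_eq ▸ hexp)]
          exact integral_prod _ hexpi'
      _ ≤ ∫ a, Real.exp (n * t ^ 2 / 2) * Real.exp (t * (g a - m)) ∂μ 0 := by
          refine integral_mono_ae hexpi'.integral_prod_left (hmgfi.const_mul _) ?_
          filter_upwards [hF.prodMk_left] with a ha
          have h := ih (fun i => μ i.succ) ha (fun z => hC _) fun x k y => by
            simpa only [Fin.cons_update] using hd (Fin.cons a x) k.succ y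
          have e : ∀ z, Real.exp (t * (f (Fin.cons a z) - m)) =
              Real.exp (t * (f (Fin.cons a z) - g a)) * Real.exp (t * (g a - m)) := fun z => by
            rw [← Real.exp_add]; ring_nf
          simp only [e]
          rw [integral_mul_const]
          gcongr
      _ ≤ Real.exp (n * t ^ 2 / 2) * Real.exp (t ^ 2 / 2) := by
          rw [integral_const_mul]
          gcongr
          simpa using hmgf
      _ = Real.exp ((n + 1 : ℕ) * t ^ 2 / 2) := by
          rw [← Real.exp_add]; push_cast; ring_nf

end Pi

/-! ### Combining Cantelli and sub-Gaussian tails. -/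

section Tail

variable {Ω : Type*} [MeasurableSpace Ω] {P : Measure Ω} [IsProbabilityMeasure P]

/-- Cantelli's inequality. -/
theorem measureReal_sub_integral_ge_le {Y : Ω → ℝ} (hY : MemLp Y 2 P) {t : ℝ} (ht : 0 < t) :
    P.real {ω | t ≤ Y ω - ∫ ω', Y ω' ∂P} ≤ Var[Y; P] / (Var[Y; P] + t ^ 2) := by
  set m := ∫ ω', Y ω' ∂P
  set V := Var[Y; P] with hV
  have hV0 : 0 ≤ V := variance_nonneg Y P
  have hZ : MemLp (fun ω => Y ω - m) 2 P := hY.sub (memLp_const m)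
  have hZm : ∫ ω, (Y ω - m) ∂P = 0 := by
    rw [integral_sub (hY.integrable one_le_two) (integrable_const _)]; simp [m]
  have hZV : ∫ ω, (Y ω - m) ^ 2 ∂P = V := (variance_eq_integral hY.aemeasurable).symm
  -- `V / t` is the optimal shift in Markov's inequality for the shifted square.
  have hs : 0 ≤ V / t := by positivity
  have hW : Integrable (fun ω => (Y ω - m + V / t) ^ 2) P :=
    (hZ.add (memLp_const (V / t))).integrable_sq
  have hWint : ∫ ω, (Y ω - m + V / t) ^ 2 ∂P = V + (V / t) ^ 2 := by
    have : ∀ ω, (Y ω - m + V / t) ^ 2 = (Y ω - m) ^ 2 + 2 * (V / t) * (Y ω - m) + (V / t) ^ 2 :=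
      fun ω => by ring
    have hlin : Integrable (fun ω => 2 * (V / t) * (Y ω - m)) P :=
      (hZ.integrable one_le_two).const_mul _
    have hquad : Integrable (fun ω => (Y ω - m) ^ 2 + 2 * (V / t) * (Y ω - m)) P :=
      hZ.integrable_sq.add hlin
    simp only [this]
    rw [integral_add hquad (integrable_const _), integral_add hZ.integrable_sq hlin,
      integral_const_mul, hZm, hZV]
    simp
  have hmarkov := mul_meas_ge_le_integral_of_nonneg (μ := P)
    (.of_forall fun ω => sq_nonneg (Y ω - m + V / t)) hW ((t + V / t) ^ 2)
  rw [hWint] at hmarkov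
  have hle : P.real {ω | t ≤ Y ω - m} ≤
      P.real {ω | (t + V / t) ^ 2 ≤ (Y ω - m + V / t) ^ 2} := by
    refine measureReal_mono fun ω (hω : t ≤ Y ω - m) => ?_
    show (t + V / t) ^ 2 ≤ (Y ω - m + V / t) ^ 2
    gcongr
  have hpos : 0 < (t + V / t) ^ 2 := by positivity
  calc P.real {ω | t ≤ Y ω - m} ≤ (V + (V / t) ^ 2) / (t + V / t) ^ 2 := by
        rw [le_div_iff₀' hpos]
        exact (mul_le_mul_of_nonneg_left hle hpos.le).trans hmarkov
    _ = V / (V + t ^ 2) := by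
        have : V + t ^ 2 ≠ 0 := by positivity
        field_simp
        ring

/-- From `log (1 + x) ≥ 2 x / (x + 2)` at `x = t ^ 2 / V`, it suffices that `t ^ 2 + 2 V ≤ 4 (V + t
b)`, which `t ≤ 4 b` ensures. -/
theorem div_add_le_exp_neg {V t b : ℝ} (hV : 0 ≤ V) (ht : 0 < t) (hb : t ≤ 4 * b) :
    V / (V + t ^ 2) ≤ Real.exp (-(t ^ 2 / (2 * (V + t * b)))) := by
  rcases hV.eq_or_lt with rfl | hV
  · simpa using (Real.exp_pos _).le
  have hb' : 0 < b := by linarith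
  have h := Real.le_log_one_add_of_nonneg (x := t ^ 2 / V) (by positivity)
  rw [show 1 + t ^ 2 / V = (V + t ^ 2) / V by field_simp] at h
  rw [← Real.log_le_iff_le_exp (by positivity), ← inv_div, Real.log_inv, neg_le_neg_iff]
  refine le_trans ?_ h
  rw [show 2 * (t ^ 2 / V) / (t ^ 2 / V + 2) = t ^ 2 * 2 / (t ^ 2 + 2 * V) by field_simp,
    mul_div_assoc, div_eq_mul_one_div (t ^ 2)]
  refine mul_le_mul_of_nonneg_left ?_ (sq_nonneg t)
  rw [div_le_div_iff₀ (by positivity) (by positivity)]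
  nlinarith [mul_le_mul_of_nonneg_left hb ht.le]

/-- For a variable that is sub-Gaussian with variance proxy `n`, a Bernstein bound in terms of the
true variance: Cantelli's inequality covers `t ≤ 3 √n`, the sub-Gaussian tail the rest. -/
theorem measureReal_ge_le_exp_of_hasSubgaussianMGF {Y : Ω → ℝ} {n : ℕ} (hn : 0 < n)
    (hY : MemLp Y 2 P) (hsub : HasSubgaussianMGF (fun ω => Y ω - ∫ ω', Y ω' ∂P) n P)
    {c : ℝ} (hc : 3 / 4 ≤ c) {t : ℝ} (ht : 0 < t) :
    P.real {ω | t ≤ Y ω - ∫ ω', Y ω' ∂P} ≤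
      Real.exp (-(t ^ 2 / (2 * (Var[Y; P] + c * t * √(n : ℝ))))) := by
  have hV := variance_nonneg Y P
  have hs : 0 < √(n : ℝ) := Real.sqrt_pos.2 (by exact_mod_cast hn)
  -- Below the threshold, `t ≤ 4 c √n` as `c ≥ 3 / 4`; above it, `c t √n ≥ 9 n / 4`, so the
  -- denominator exceeds that of the sub-Gaussian bound.
  rcases le_total t (3 * √(n : ℝ)) with h | h
  · refine (measureReal_sub_integral_ge_le hY ht).trans ?_
    rw [show c * t * √(n : ℝ) = t * (c * √(n : ℝ)) by ring]
    refine div_add_le_exp_neg hV ht ?_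
    nlinarith
  · refine (hsub.measure_ge_le ht.le).trans ?_
    rw [Real.exp_le_exp, neg_div]
    have hn' : (0 : ℝ) < n := by exact_mod_cast hn
    have hsq : √(n : ℝ) * √(n : ℝ) = n := Real.mul_self_sqrt hn'.le
    have : (n : ℝ) ≤ Var[Y; P] + c * t * √(n : ℝ) := by
      have h₁ : 3 * √(n : ℝ) * √(n : ℝ) ≤ t * √(n : ℝ) := by gcongr
      have h₂ : 3 / 4 * (t * √(n : ℝ)) ≤ c * (t * √(n : ℝ)) := by gcongr
      nlinarith
    push_cast
    rw [neg_le_neg_iff]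
    gcongr

end Tail

/-! ### Self-bounding functions and the main theorem. -/

theorem three_quarters_le_two_rpow_div_three : (3 / 4 : ℝ) ≤ (2 : ℝ) ^ (3 / 2 : ℝ) / 3 := by
  have h : (9 / 4 : ℝ) ≤ (2 : ℝ) ^ (3 / 2 : ℝ) := by
    rw [show (3 / 2 : ℝ) = 3 * (1 / 2) by norm_num, Real.rpow_mul zero_le_two,
      ← Real.sqrt_eq_rpow]
    refine Real.le_sqrt_of_sq_le ?_
    norm_num
  linarith

/-- A variable with values in an interval `[c, c + 1]` has variance at most its distance in mean
from `c`. -/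
theorem variance_le_integral_sub {α : Type*} [MeasurableSpace α] {μ : Measure α}
    [IsProbabilityMeasure μ] {g : α → ℝ} (hg : AEStronglyMeasurable g μ) {c : ℝ}
    (h₀ : ∀ x, c ≤ g x) (h₁ : ∀ x, g x ≤ c + 1) : Var[g; μ] ≤ ∫ x, g x ∂μ - c := by
  have hC : ∀ x, |g x - c| ≤ 1 := fun x => by
    rw [abs_le]; constructor <;> linarith [h₀ x, h₁ x]
  have hgc : AEStronglyMeasurable (fun x => g x - c) μ := hg.sub aestronglyMeasurable_const
  have hi := integrable_of_abs_le hgc hC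
  have hgi : Integrable g μ := (hi.add (integrable_const c)).congr (.of_forall fun x => by simp)
  rw [← variance_sub_const hg c]
  calc Var[fun x => g x - c; μ] ≤ ∫ x, (g x - c) ^ 2 ∂μ := variance_le_expectation_sq hgc
    _ ≤ ∫ x, (g x - c) ∂μ := by
        refine integral_mono (integrable_sq_of_abs_le hgc hC) hi fun x => ?_
        show (g x - c) ^ 2 ≤ g x - c
        nlinarith [h₀ x, h₁ x]
    _ = ∫ x, g x ∂μ - c := by rw [integral_sub hgi (integrable_const c)]; simp

/-- The variance of a self-bounding function of independent variables is at most its mean. -/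
theorem variance_pi_le_integral_of_selfBounding {X : Type*} [MeasurableSpace X] {n : ℕ}
    (μ : Fin n → Measure X) [∀ i, IsProbabilityMeasure (μ i)]
    {f : (Fin n → X) → ℝ} {C : ℝ} (hf : AEStronglyMeasurable f (Measure.pi μ))
    (hC : ∀ x, |f x| ≤ C) (d : Fin n → (Fin n → X) → ℝ)
    (hd : ∀ k x y, d k (Function.update x k y) = d k x)
    (h₀ : ∀ k x, d k x ≤ f x) (h₁ : ∀ k x, f x ≤ d k x + 1)
    (hsum : ∀ x, ∑ k, (f x - d k x) ≤ f x) :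
    Var[f; Measure.pi μ] ≤ ∫ x, f x ∂Measure.pi μ := by
  have hfi := integrable_of_abs_le hf hC
  have hu := fun k => hf.comp_measurePreserving (measurePreserving_update μ k)
  have hui := fun k => integrable_of_abs_le (hu k) fun _ => hC _
  have hv := integrable_variance_update μ hf hC
  have hE : ∀ k, ∫ x, ∫ y, f (Function.update x k y) ∂μ k ∂Measure.pi μ =
      ∫ x, f x ∂Measure.pi μ := fun k => by
    have hp := measurePreserving_update μ k
    conv_rhs => rw [← hp.map_eq]
    rw [integral_map hp.aemeasurable (hp.map_eq.symm ▸ hf)]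
    exact (integral_prod _ (hui k)).symm
  have hEi : ∀ k, Integrable (fun x => ∫ y, f (Function.update x k y) ∂μ k) (Measure.pi μ) :=
    fun k => (hui k).integral_prod_left
  have hdi : ∀ k, Integrable (fun x => ∫ y, f (Function.update x k y) ∂μ k - f x)
      (Measure.pi μ) := fun k => (hEi k).sub hfi
  -- Write `E_k f - d_k = (E_k f - f) + (f - d_k)`: the first term has mean zero, the second sums to
  -- at most `f`. As `d` is eliminated pointwise, it is never integrated.
  have hpt : ∀ᵐ x ∂Measure.pi μ, ∑ k, Var[fun y => f (Function.update x k y); μ k] ≤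
      ∑ k, (∫ y, f (Function.update x k y) ∂μ k - f x) + f x := by
    filter_upwards [ae_all_iff.2 fun k => (hu k).prodMk_left] with x hx
    have h : ∀ k, Var[fun y => f (Function.update x k y); μ k] ≤
        ∫ y, f (Function.update x k y) ∂μ k - d k x := fun k =>
      variance_le_integral_sub (hx k) (fun y => hd k x y ▸ h₀ k _) fun y => hd k x y ▸ h₁ k _
    have h' := Finset.sum_le_sum fun k (_ : k ∈ Finset.univ) => h k
    have h'' := hsum x
    simp only [Finset.sum_sub_distrib] at h' h'' ⊢
    linarith
  calc Var[f; Measure.pi μ]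
      ≤ ∑ k, ∫ x, Var[fun y => f (Function.update x k y); μ k] ∂Measure.pi μ :=
        variance_pi_le_sum μ hf hC
    _ = ∫ x, ∑ k, Var[fun y => f (Function.update x k y); μ k] ∂Measure.pi μ :=
        (integral_finsetSum _ fun k _ => hv k).symm
    _ ≤ ∫ x, (∑ k, (∫ y, f (Function.update x k y) ∂μ k - f x) + f x) ∂Measure.pi μ :=
        integral_mono_ae (integrable_finsetSum _ fun k _ => hv k)
          ((integrable_finsetSum _ fun k _ => hdi k).add hfi) hpt
    _ = ∫ x, f x ∂Measure.pi μ := by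
        rw [integral_add (integrable_finsetSum _ fun k _ => hdi k) hfi,
          integral_finsetSum _ fun k _ => hdi k]
        simp only [fun k => integral_sub (hEi k) hfi, hE, sub_self, Finset.sum_const_zero,
          zero_add]

/-- The bounded differences inequality: a function of `n` independent variables that changes by at
most `1` with each of them is sub-Gaussian with variance proxy `n`. -/
theorem hasSubgaussianMGF_pi {X : Type*} [MeasurableSpace X] {n : ℕ}
    (μ : Fin n → Measure X) [∀ i, IsProbabilityMeasure (μ i)]
    {f : (Fin n → X) → ℝ} {C : ℝ} (hf : AEStronglyMeasurable f (Measure.pi μ))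
    (hC : ∀ x, |f x| ≤ C) (hd : ∀ x k y, |f (Function.update x k y) - f x| ≤ 1) :
    HasSubgaussianMGF (fun x => f x - ∫ x', f x' ∂Measure.pi μ) n (Measure.pi μ) where
  integrable_exp_mul t := by
    exact (hasSubgaussianMGF_of_mem_Icc (a := -C) (b := C) hf.aemeasurable
      (.of_forall fun x => abs_le.1 (hC x))).integrable_exp_mul t
  mgf_le t := by simpa [mgf] using integral_exp_mul_sub_le μ hf hC hd t

theorem mainTheorem10 {Ω : Type*} [MeasurableSpace Ω] (P : Measure Ω) [IsProbabilityMeasure P]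
    {X : Type*} [MetricSpace X] [CompleteSpace X] [TopologicalSpace.SeparableSpace X]
    [MeasurableSpace X] [BorelSpace X]
    (n : ℕ) (ξ : Fin n → Ω → X) (hξ : ∀ i, Measurable (ξ i)) (hindep : iIndepFun ξ P)
    (A : Set (Set X))
    (hA : AEMeasurable (vcEntropy A : (Fin n → X) → ℝ) (P.map (fun ω i => ξ i ω))) :
    (A.Nonempty → Var[randomVCEntropy A ξ; P] ≤ ∫ ω, randomVCEntropy A ξ ω ∂P) ∧
    ∀ t : ℝ, 0 < t →
      P.real {ω | t ≤ randomVCEntropy A ξ ω - ∫ ω', randomVCEntropy A ξ ω' ∂P} ≤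
        Real.exp (-(t ^ 2 / (2 * (Var[randomVCEntropy A ξ; P] +
          (2 : ℝ) ^ (3 / 2 : ℝ) / 3 * t * √(n : ℝ))))) ∧
      P.real {ω | t ≤ -randomVCEntropy A ξ ω - ∫ ω', -randomVCEntropy A ξ ω' ∂P} ≤
        Real.exp (-(t ^ 2 / (2 * (Var[fun ω => -randomVCEntropy A ξ ω; P] +
          (2 : ℝ) ^ (3 / 2 : ℝ) / 3 * t * √(n : ℝ))))) := by
  have hprob : ∀ i, IsProbabilityMeasure (P.map (ξ i)) := fun i =>
    Measure.isProbabilityMeasure_map (hξ i).aemeasurable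
  have hmp : MeasurePreserving (fun ω i => ξ i ω) P (Measure.pi fun i => P.map (ξ i)) :=
    ⟨measurable_pi_lambda _ hξ,
      (iIndepFun_iff_map_fun_eq_pi_map fun i => (hξ i).aemeasurable).1 hindep⟩
  rw [hmp.map_eq] at hA
  have hAs := hA.aestronglyMeasurable
  obtain ⟨C, hC⟩ := exists_abs_vcEntropy_le A n
  have hmean : ∫ ω, randomVCEntropy A ξ ω ∂P =
      ∫ x, vcEntropy A x ∂Measure.pi fun i => P.map (ξ i) := by
    rw [← hmp.map_eq, integral_map hmp.aemeasurable (hmp.map_eq.symm ▸ hAs)]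
    rfl
  have hHm : AEStronglyMeasurable (randomVCEntropy A ξ) P := hAs.comp_measurePreserving hmp
  have hHC : ∀ ω, |randomVCEntropy A ξ ω| ≤ C := fun ω => hC _
  refine ⟨fun hne => ?_, fun t ht => ?_⟩
  · have hvar : Var[randomVCEntropy A ξ; P] =
        Var[vcEntropy A; Measure.pi fun i => P.map (ξ i)] := hmp.variance_fun_comp hA
    rw [hvar, hmean]
    exact variance_pi_le_integral_of_selfBounding _ hAs hC (deletedEntropy A)
      (deletedEntropy_update A) (deletedEntropy_le hne) (vcEntropy_le_deletedEntropy_add_one hne)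
      (sum_vcEntropy_sub_deletedEntropy_le hne)
  -- For `n = 0` the entropy is constant, so the events are empty.
  rcases n.eq_zero_or_pos with rfl | hn
  · have hconst : randomVCEntropy A ξ = fun _ => vcEntropy A Fin.elim0 :=
      funext fun ω => congrArg (vcEntropy A) (Subsingleton.elim _ _)
    constructor <;> simpa [hconst, ht.not_ge] using (Real.exp_pos _).le
  have hsub : HasSubgaussianMGF
      (fun ω => randomVCEntropy A ξ ω - ∫ ω', randomVCEntropy A ξ ω' ∂P) n P := by
    have h := hasSubgaussianMGF_pi _ hAs hC (abs_vcEntropy_update_sub_le A)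
    rw [← hmean] at h
    rw [← hmp.map_eq] at h
    exact h.of_map hmp.aemeasurable
  have hc := three_quarters_le_two_rpow_div_three
  refine ⟨measureReal_ge_le_exp_of_hasSubgaussianMGF hn (memLp_two_of_abs_le hHm hHC) hsub hc ht,
    measureReal_ge_le_exp_of_hasSubgaussianMGF hn (memLp_two_of_abs_le hHm hHC).neg ?_ hc ht⟩
  convert hsub.neg using 1
  ext ω
  simp only [Pi.neg_apply, integral_neg]
  ring
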